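/- Let $\Gamma$ be an infinite countable abelian group, written additively. For a finite discrete set $A$, give $A^\Gamma$ the product topology and the shift action $\sigma_w(x)_v = x_{v+w}$; a $\Gamma$-subshift is a (possibly empty) closed shift-invariant subset of some such $A^\Gamma$, and a map between $\Gamma$-subshifts is a continuous $\Gamma$-equivariant function. For $x \in A^\Gamma$ and $F\subseteq\Gamma$ put $\mathrm{stab}(x) = \{v \in \Gamma : \sigma_v(x) = x\}$ and let $x_F\in A^F$ be the restriction of $x$ to $F$. For $\Gamma$-subshifts $X, Y$ (possibly over different alphabets) write $X \rightsquigarrow Y$ if for every $x \in X$ there is $y \in Y$ with $\mathrm{stab}(x) \le \mathrm{stab}(y)$. A $\Gamma$-subshift $Y$ has the map extension property if for every $\Gamma$-subshift $X$ with $X \rightsquigarrow Y$ and every map $\tilde\pi : \tilde X \to Y$ from a (possibly empty) $\Gamma$-subshift $\tilde X \subseteq X$, there is a map $\pi : X \to Y$ extending $\tilde\pi$. Let $Y \subseteq A^\Gamma$ be a $\Gamma$-subshift with the map extension property. Then: (i) $Y$ is strongly irreducible: there is a nonempty finite set $K \subseteq \Gamma$ such that for all $F_1, F_2 \subseteq \Gamma$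 with $(K+F_1) \cap (K+F_2) = \emptyset$ and all $x^{(1)}, x^{(2)} \in Y$ there is $x \in Y$ with $x_{F_1} = x^{(1)}_{F_1}$ and $x_{F_2} = x^{(2)}_{F_2}$; and (ii) $Y$ is a shift of finite type: there are a finite set $W \subseteq \Gamma$ and a set $\mathcal F \subseteq A^W$ such that $Y = \{ y \in A^\Gamma : \sigma_v(y)_W \notin \mathcal F \text{ for all } v \in \Gamma \}$. -/

import Mathlib

open scoped Pointwise

namespace MapExtension

open SymbolicDynamics.FullShift

variable {Γ : Type*} [AddCommGroup Γ]

/-- The stabilizer `{v | σ_v x = x}` of a configuration `x`, as a subgroup of `Γ`. -/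
def stab {A : Type*} (x : Γ → A) : AddSubgroup Γ where
  carrier := {v | shift v x = x}
  zero_mem' := shift_zero x
  add_mem' := by
    intro a b ha hb
    simp only [Set.mem_ofPred_eq] at ha hb ⊢
    rw [shift_add, ha, hb]
  neg_mem' := by
    intro a ha
    simp only [Set.mem_ofPred_eq] at ha ⊢
    conv_lhs => rw [← ha]
    rw [← shift_add, add_neg_cancel, shift_zero]

/-- `X ⇝ Y`: every stabilizer of a point of `X` is contained in the stabilizer of some point
of `Y`. -/
def StabLeads {A B : Type*} [TopologicalSpace A] [TopologicalSpace B]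
    (X : Subshift B Γ) (Y : Subshift A Γ) : Prop :=
  ∀ x ∈ X.carrier, ∃ y ∈ Y.carrier, stab x ≤ stab y

/-- Maps of `Γ`-subshifts: continuous shift-equivariant functions. -/
structure SubshiftMap {A B : Type*} [TopologicalSpace A] [TopologicalSpace B]
    (X : Subshift B Γ) (Y : Subshift A Γ) where
  toFun : X.carrier → Y.carrier
  continuous_toFun : Continuous toFun
  map_shift : ∀ (v : Γ) (x : X.carrier),
    (toFun ⟨shift v x.1, X.mapsTo v x.2⟩ : Γ → A) = shift v (toFun x).1

/-- The map extension property: for every `Γ`-subshift `X` (over any finite discrete alphabet)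
with `X ⇝ Y` and every (possibly empty) subshift `X' ⊆ X`, each map `X' → Y` extends to a map
`X → Y`. Every finite alphabet is in bijection with one in `Type`. -/
def HasMapExtensionProperty {A : Type*} [TopologicalSpace A] (Y : Subshift A Γ) : Prop :=
  ∀ (B : Type) [Finite B] [TopologicalSpace B] [DiscreteTopology B] (X X' : Subshift B Γ)
    (hX' : X'.carrier ⊆ X.carrier), StabLeads X Y → ∀ f : SubshiftMap X' Y,
      ∃ g : SubshiftMap X Y, ∀ x : X'.carrier, g.toFun ⟨x.1, hX' x.2⟩ = f.toFun x

/-- `Y` is of finite type: it is defined by a set of forbidden patterns on one finite window. -/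
def IsOfFiniteType {A : Type*} [TopologicalSpace A] (Y : Subshift A Γ) : Prop :=
  ∃ (W : Finset Γ) (F : Set (W → A)),
    Y.carrier = {y : Γ → A | ∀ v : Γ, (fun w : W => shift v y w.1) ∉ F}

/-- `F₁` and `F₂` are `K`-disjoint: `(K + F₁) ∩ (K + F₂) = ∅`. -/
def KDisjoint (K F₁ F₂ : Set Γ) : Prop :=
  Disjoint (K + F₁) (K + F₂)

/-- `Y` is strongly irreducible: there is a nonempty finite irreducibility window `K`. -/
def IsStronglyIrreducible {A : Type*} [TopologicalSpace A] (Y : Subshift A Γ) : Prop :=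
  ∃ K : Finset Γ, K.Nonempty ∧ ∀ F₁ F₂ : Set Γ, KDisjoint (K : Set Γ) F₁ F₂ →
    ∀ x₁ ∈ Y.carrier, ∀ x₂ ∈ Y.carrier,
      ∃ x ∈ Y.carrier, Set.EqOn x x₁ F₁ ∧ Set.EqOn x x₂ F₂

end MapExtension

namespace MapExtension

open SymbolicDynamics.FullShift

section

variable {Γ : Type*} [AddCommGroup Γ] {A : Type*} [TopologicalSpace A]

/-! Stabilizers never obstruct extension from a subshift that maps letterwise into `Y`. On such a
subshift, a second letter map `φ` is defined where its image lies in `Y`, and the property extends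
it to a block code into `Y`. Any input that looks locally like a point of that domain is therefore
output as `φ` there. Both claims follow by choosing the letters. -/

/-- A map of subshifts is a sliding block code: its value at a site depends only on the
coordinates in a finite window around that site. -/
theorem SubshiftMap.exists_window {B : Type*} [Finite B] [TopologicalSpace B]
    [DiscreteTopology B] [DiscreteTopology A] {X : Subshift B Γ} {Y : Subshift A Γ}
    (f : SubshiftMap X Y) :
    ∃ K : Finset Γ, ∀ (x x' : X.carrier) (v : Γ), (∀ k ∈ K, x.1 (v + k) = x'.1 (v + k)) →
      (f.toFun x).1 v = (f.toFun x').1 v := by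
  classical
  have hc : Continuous fun x : X.carrier => (f.toFun x).1 0 :=
    (continuous_apply 0).comp (continuous_subtype_val.comp f.continuous_toFun)
  have hloc : ∀ x : X.carrier, ∃ U : Finset Γ,
      ∀ x' : X.carrier, x'.1 ∈ cylinder U x.1 → (f.toFun x').1 0 = (f.toFun x).1 0 := by
    intro x
    have hopen := (isOpen_discrete {(f.toFun x).1 0}).preimage hc
    obtain ⟨V, hV, hVeq⟩ := isOpen_induced_iff.mp hopen
    have hxV : x.1 ∈ V := by
      have : x ∈ Subtype.val ⁻¹' V := by rw [hVeq]; rfl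
      exact this
    obtain ⟨U, u, hu, hUV⟩ := isOpen_pi_iff.mp hV x.1 hxV
    refine ⟨U, fun x' hx' => ?_⟩
    have : x' ∈ Subtype.val ⁻¹' V := hUV fun i hi => by
      rw [hx' i hi]
      exact (hu i hi).2
    rw [hVeq] at this
    exact this
  choose U hU using hloc
  have : CompactSpace X.carrier := isCompact_iff_compactSpace.mp X.isClosed.isCompact
  obtain ⟨t, ht⟩ := isCompact_univ.elim_finite_subcover
    (fun x : X.carrier => (Subtype.val ⁻¹' cylinder (U x) x.1 : Set X.carrier))
    (fun x => (isOpen_cylinder (U x) x.1).preimage continuous_subtype_val)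
    (fun x _ => Set.mem_iUnion.mpr ⟨x, fun _ _ => rfl⟩)
  have hzero : ∀ x x' : X.carrier, (∀ k ∈ t.biUnion U, x.1 k = x'.1 k) →
      (f.toFun x).1 0 = (f.toFun x').1 0 := by
    intro x x' h
    obtain ⟨z, hz, hxz⟩ := Set.mem_iUnion₂.mp (ht (Set.mem_univ x))
    rw [hU z x hxz, hU z x' fun i hi => ?_]
    rw [← h i (Finset.mem_biUnion.mpr ⟨z, hz, hi⟩)]
    exact hxz i hi
  refine ⟨t.biUnion U, fun x x' v h => ?_⟩
  have := hzero ⟨_, X.mapsTo v x.2⟩ ⟨_, X.mapsTo v x'.2⟩ h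
  rw [f.map_shift, f.map_shift] at this
  simpa using this

/-- The configurations sent into `Y` by a letter-to-letter map. -/
def comapLetter {B : Type*} [TopologicalSpace B] [DiscreteTopology B] (φ : B → A)
    (Y : Subshift A Γ) : Subshift B Γ where
  carrier := {x | φ ∘ x ∈ Y.carrier}
  isClosed := Y.isClosed.preimage <| continuous_pi fun v =>
    continuous_of_discreteTopology.comp (continuous_apply v)
  mapsTo v _ hx := Y.mapsTo v hx

theorem comapLetter_stabLeads {B : Type*} [TopologicalSpace B] [DiscreteTopology B] (φ : B → A)
    (Y : Subshift A Γ) : StabLeads (comapLetter φ Y) Y := fun x hx =>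
  ⟨φ ∘ x, hx, fun _ hv => congrArg (φ ∘ ·) hv⟩

/-- If `Y` has the map extension property, then a letter-to-letter map `φ`, restricted to the
configurations that it sends into `Y`, extends to a block code into `Y` on the configurations
sent into `Y` by another letter-to-letter map `ψ`. -/
theorem HasMapExtensionProperty.exists_letter_extension [DiscreteTopology A]
    {Y : Subshift A Γ} (hY : HasMapExtensionProperty Y) {B : Type*} [Finite B] (ψ φ : B → A) :
    ∃ K : Finset Γ, ∀ x : Γ → B, ψ ∘ x ∈ Y.carrier → ∃ y ∈ Y.carrier, ∀ (x' : Γ → B) (v : Γ),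
      ψ ∘ x' ∈ Y.carrier → φ ∘ x' ∈ Y.carrier → (∀ k ∈ K, x (v + k) = x' (v + k)) →
        y v = φ (x' v) := by
  -- `HasMapExtensionProperty` only quantifies over alphabets in `Type`.
  obtain ⟨n, ⟨e⟩⟩ := Finite.exists_equiv_fin B
  let X := comapLetter (ψ ∘ e.symm) Y
  let Z := comapLetter (φ ∘ e.symm) Y
  let X' : Subshift (Fin n) Γ :=
    { carrier := X.carrier ∩ Z.carrier
      isClosed := X.isClosed.inter Z.isClosed
      mapsTo := fun v _ hx => ⟨X.mapsTo v hx.1, Z.mapsTo v hx.2⟩ }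
  let f : SubshiftMap X' Y :=
    { toFun := fun x => ⟨(φ ∘ e.symm) ∘ x.1, x.2.2⟩
      continuous_toFun := Continuous.subtype_mk (continuous_pi fun v =>
        continuous_of_discreteTopology.comp
          ((continuous_apply v).comp continuous_subtype_val)) _
      map_shift := fun _ _ => rfl }
  obtain ⟨g, hg⟩ := hY (Fin n) X X' Set.inter_subset_left (comapLetter_stabLeads _ Y) f
  obtain ⟨K, hK⟩ := g.exists_window
  have hcode : ∀ (χ : B → A) (x : Γ → B), (χ ∘ e.symm) ∘ e ∘ x = χ ∘ x := fun χ x => by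
    funext v
    simp
  have hmem : ∀ x : Γ → B, ψ ∘ x ∈ Y.carrier → e ∘ x ∈ X.carrier := fun x hx => by
    change (ψ ∘ e.symm) ∘ e ∘ x ∈ Y.carrier
    rwa [hcode]
  refine ⟨K, fun x hx => ⟨_, (g.toFun ⟨_, hmem x hx⟩).2, fun x' v hx' hφ h => ?_⟩⟩
  have hφ' : e ∘ x' ∈ Z.carrier := by
    change (φ ∘ e.symm) ∘ e ∘ x' ∈ Y.carrier
    rwa [hcode]
  rw [hK ⟨_, hmem x hx⟩ ⟨_, hmem x' hx'⟩ v fun k hk => congrArg e (h k hk),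
    hg ⟨e ∘ x', hmem x' hx', hφ'⟩]
  exact congrFun (hcode φ x') v

/-- The Boolean track selects one of two points of `Y`. Where it is locally constant the code must
copy the selected point; where it switches, the code interpolates within `Y`. -/
theorem HasMapExtensionProperty.isStronglyIrreducible [Finite A] [DiscreteTopology A]
    {Y : Subshift A Γ} (hY : HasMapExtensionProperty Y) : IsStronglyIrreducible Y := by
  classical
  obtain ⟨K, hK⟩ := hY.exists_letter_extension (B := A × A × Bool) Prod.fst
    (fun b => if b.2.2 then b.2.1 else b.1)
  -- Adding `0` only ensures a nonempty window.
  refine ⟨insert 0 K, Finset.insert_nonempty _ _, fun F₁ F₂ hF x₁ hx₁ x₂ hx₂ => ?_⟩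
  have hsum : ∀ {F : Set Γ} {v k : Γ}, v ∈ F → k ∈ K →
      v + k ∈ ((insert 0 K : Finset Γ) : Set Γ) + F := fun hv hk =>
    ⟨_, Finset.mem_insert_of_mem hk, _, hv, add_comm _ _⟩
  obtain ⟨y, hy, hyv⟩ := hK (fun v => (x₁ v, x₂ v,
    decide (v ∉ ((insert 0 K : Finset Γ) : Set Γ) + F₁))) hx₁
  refine ⟨y, hy, fun v hv => ?_, fun v hv => ?_⟩
  · refine hyv (fun v => (x₁ v, x₂ v, false)) v hx₁ hx₁ fun k hk => ?_
    simp only [Prod.mk.injEq, true_and, decide_eq_false_iff_not, not_not]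
    exact hsum hv hk
  · refine hyv (fun v => (x₁ v, x₂ v, true)) v hx₁ hx₂ fun k hk => ?_
    simp only [Prod.mk.injEq, true_and, decide_eq_true_eq]
    exact fun h => Set.disjoint_left.mp hF h (hsum hv hk)

/-- The second track, a point of `Y`, only places the input in the code's domain. If every window of
the first track occurs in `Y`, the code copies that track everywhere, so it is itself a point of
`Y`. -/
theorem HasMapExtensionProperty.isOfFiniteType [Finite A] [DiscreteTopology A]
    {Y : Subshift A Γ} (hY : HasMapExtensionProperty Y) : IsOfFiniteType Y := by
  classical
  obtain ⟨K, hK⟩ := hY.exists_letter_extension (B := A × A) Prod.snd Prod.fst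
  refine ⟨insert 0 K, {p | ∀ y ∈ Y.carrier, p ≠ fun w : (insert 0 K : Finset Γ) => y w.1}, Set.Subset.antisymm ?_ ?_⟩
  · exact fun y hy v hv => hv _ (Y.mapsTo v hy) rfl
  · intro x hx
    have hx' : ∀ v : Γ, ∃ y ∈ Y.carrier, (fun w : (insert 0 K : Finset Γ) => shift v x w.1) = fun w : (insert 0 K : Finset Γ) => y w.1 := by
      simpa using hx
    -- Only the existence of a point of `Y` is needed; if `Y` is empty, every pattern is forbidden.
    obtain ⟨z, hz, -⟩ := hx' 0
    obtain ⟨y, hy, hyv⟩ := hK (fun v => (x v, z v)) hz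
    suffices h : ∀ v, y v = x v by rwa [show x = y from funext fun v => (h v).symm]
    intro v
    obtain ⟨u, hu, hxu⟩ := hx' v
    have hu' : shift (-v) u ∈ Y.carrier := Y.mapsTo _ hu
    have hagree : ∀ k ∈ insert 0 K, x (v + k) = shift (-v) u (v + k) := fun k hk => by
      simpa using congrFun hxu ⟨k, hk⟩
    rw [hyv (fun w => (shift (-v) u w, z w)) v hz hu' fun k hk =>
      Prod.ext (hagree k (Finset.mem_insert_of_mem hk)) rfl]
    -- Here `0` must lie in the window, to compare `u` with `x` at the site itself.
    simpa using (hagree 0 (Finset.mem_insert_self _ _)).symm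

end

end MapExtension

theorem mainTheorem7 {Γ : Type*} [AddCommGroup Γ] [Countable Γ] [Infinite Γ]
    {A : Type*} [Finite A] [TopologicalSpace A] [DiscreteTopology A]
    (Y : SymbolicDynamics.FullShift.Subshift A Γ)
    (hY : MapExtension.HasMapExtensionProperty Y) :
    MapExtension.IsStronglyIrreducible Y ∧ MapExtension.IsOfFiniteType Y :=
  ⟨hY.isStronglyIrreducible, hY.isOfFiniteType⟩
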